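/- **Setting.** Let $\mathcal L$ be a countable relational first-order language and $T$ a complete, model complete $\mathcal L$-theory. Let $V_\alpha$ ($\alpha<\omega+\omega$) be fresh unary predicates. Let $(\sigma_i)_{i<\omega}$ enumerate, each one infinitely often, all pairs $\sigma=(\varphi(\vec x,\vec y),\alpha)$, where $\varphi$ is a quantifier-free $\mathcal L$-formula with a distinguished splitting $\vec x,\vec y$ of its free variables and $\alpha<\omega+\omega$. Finite structures $M_n$ for $\mathcal L\cup\{V_\alpha:\alpha<\omega+\omega\}$, in which the $V_\alpha$ form an increasing chain, are constructed as follows. * $M_0$ is a one-element substructure of a model of $T$, whose element lies in every $V_\alpha$. * $M_{n+1}$ is obtained from $M_n$ by treating $\sigma_0,\dots,\sigma_n$ one after the other, rearranged so that their levels $\alpha$ are nondecreasing. To treat $(\varphi(\vec x,\vec y),\alpha)$, enumerate the tuples $\vec a$ of length $|\vec x|$ from $V_\alpha$ of the current structure, and for each of them in turn do the following with the structure $S$ reached so far: if there is $\vec b$ in $V_{\alpha+1}^S$ with $S\models\varphi(\vec a,\vec b)$, change nothing; otherwise, if there are an extension $N\supseteq S$ with $N\models T$ and $\vec b$ in $N$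 with $N\models\varphi(\vec a,\vec b)$, choose such $N,\vec b$ and replace $S$ by its extension $S\cup\{\vec b\}\subseteq N$, putting those elements of $\vec b$ that are not in $V^S_{\alpha+1}$ into $V_\beta$ for all $\beta\ge\alpha+1$, but not into $V_\alpha$; otherwise change nothing. Let $\mathcal U$ be a nonprincipal ultrafilter on $\omega$, $M=\prod_{\mathcal U}M_n$, $V_{<\omega}^M=\bigcup_{n<\omega}V_n^M$, and let $M'$ be the $\mathcal L$-substructure of $M$ with universe $\bigcup_{n<\omega}V_{\omega+n}^M$. For an $\mathcal L$-formula $\varphi(\vec x,\vec b)$ with parameters in $M$ let $\varphi_\omega(\vec x,\vec b)$ be $\varphi(\vec x,\vec b)\wedge\vec x\in V_\omega$. For a definable $X\subseteq M^m$ with nonstandard cardinality $|X|\in\mathbb R^*=\mathbb R^{\omega}/\mathcal U$, let $\delta_M(X)$ be the image of $\log|X|$ in $\mathbb R^*/\mathcal C$, where $\mathcal C$ is the convex hull of $\mathbb Z$ in $\mathbb R^*$, and $\delta_M(X)=-\infty$ if $|X|=0$; the values lie in the linearly ordered set $\mathbb R^*/\mathcal C\cup\{-\infty\}$. Write $\delta_M(\varphi(\vec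 x,\vec b))$ for $\delta_M(X)$, where $X$ is the subset of $M^m$ defined in $M$ by $\varphi_\omega(\vec x,\vec b)$. The notions of consistency, implication, type and dividing below refer to the $\mathcal L$-structure $M'$. In particular, $\varphi(x,b)$ divides over $a$ if in some elementary extension of $M'$ there are realizations $(b_i)_{i<\omega}$ of $\operatorname{tp}_{\mathcal L}(b/a)$ such that, for some $k\ge1$, for no $k$ distinct indices $i$ do the formulas $\varphi(x,b_i)$ have a common solution. **Proposition.** Let $\psi(x,a)$ and $\varphi(x,b)$ be existential $\mathcal L$-formulas, where $x$, $a$, $b$ are finite tuples, $a$ is from $V_{<\omega}^M$ and $b$ is from $V_\omega^M$. Suppose that $\psi(x,a)$ is consistent, that $\varphi(x,b)$ implies $\psi(x,a)$, and that $\varphi(x,b)$ divides over $a$. Then there is $b^\#$ from $V_\omega^M$ with $b^\#\equiv_{\mathcal L,a}b$ and $$\delta_M(\varphi(x,b^\#))<\delta_M(\psi(x,a)).$$ -/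

import Mathlib

open FirstOrder FirstOrder.Language Filter

namespace FinePseudofinite

/-- `T` is model complete: every embedding between models of `T` is elementary. -/
def IsModelComplete {L : FirstOrder.Language.{0, 0}} (T : L.Theory) : Prop :=
  ∀ (A B : Theory.ModelType.{0, 0, 0} T) (f : A ↪[L] B) (n : ℕ) (χ : L.Formula (Fin n))
    (x : Fin n → A), χ.Realize (f ∘ x) ↔ χ.Realize x

/-! ### The levels `α < ω + ω` and the tasks `(φ(x, y), α)` -/

/-- The ordinals below `ω + ω`: the pair `(false, n)` stands for `n` and `(true, n)` for `ω + n`.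
The order is the lexicographic one. -/
abbrev Level : Type := Bool ×ₗ ℕ

/-- The level `n < ω`. -/
def Level.fin (n : ℕ) : Level := toLex (false, n)

/-- The level `ω + n`. -/
def Level.omegaAdd (n : ℕ) : Level := toLex (true, n)

/-- The level `α + 1`. -/
def Level.next (α : Level) : Level := toLex ((ofLex α).1, (ofLex α).2 + 1)

/-- A pair `σ = (φ(x, y), α)`: a quantifier-free formula together with a distinguished splitting
of its free variables into tuples `x` and `y`, and a level `α`. -/
structure Task (L : FirstOrder.Language.{0, 0}) where
  /-- length of the tuple `x` -/
  xLen : ℕ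
  /-- length of the tuple `y` -/
  yLen : ℕ
  /-- the formula `φ(x, y)` -/
  formula : L.Formula (Fin xLen ⊕ Fin yLen)
  isQF : formula.IsQF
  level : Level

/-! ### The finite structures -/

/-- A finite nonempty structure for the language `L ∪ {V_α : α < ω + ω}` in which the
interpretations of the `V_α` form an increasing chain. -/
structure Stage (L : FirstOrder.Language.{0, 0}) where
  carrier : Type
  [str : L.Structure carrier]
  [finite : Finite carrier]
  [nonempty : Nonempty carrier]
  /-- the interpretation of `V_α` -/
  V : Level → Set carrier
  mono : Monotone V

instance {L : FirstOrder.Language.{0, 0}} : CoeSort (Stage L) Type := ⟨Stage.carrier⟩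

attribute [instance] Stage.str Stage.finite Stage.nonempty

variable {L : FirstOrder.Language.{0, 0}}

/-- There is a tuple `b` in `V_{α+1}` with `φ(a, b)`, where `τ = (φ, α)`. -/
def Stage.HasWitness (S : Stage L) (τ : Task L) (a : Fin τ.xLen → S) : Prop :=
  ∃ b : Fin τ.yLen → S, (∀ j, b j ∈ S.V τ.level.next) ∧ τ.formula.Realize (Sum.elim a b)

/-- `WitnessStep T τ S a S' g`: the structure `S'`, an extension of `S` through the embedding `g`,
is a possible result of treating the tuple `a` from `S` for the pair `τ = (φ, α)`.

* If there already is a witness `b` for `φ(a, ·)` in `V_{α+1}`, nothing is changed.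
* Otherwise, if some extension `N ⊨ T` of `S` contains a tuple `b` with `N ⊨ φ(a, b)`, then
  `S'` is `S ∪ {b}` for one such choice; the elements of `b` that were not in `V_{α+1}` are put
  into `V_{α+1}` (hence into all later levels) and not into `V_α`.
* Otherwise nothing is changed. -/
inductive WitnessStep (T : L.Theory) (τ : Task L) (S : Stage L) (a : Fin τ.xLen → S) :
    (S' : Stage L) → (S ↪[L] S') → Prop
  | old (h : S.HasWitness τ a) : WitnessStep T τ S a S (Embedding.refl L S)
  | new (h : ¬ S.HasWitness τ a) (S' : Stage L) (g : S ↪[L] S')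
      (N : Theory.ModelType.{0, 0, 0} T) (f : S' ↪[L] N) (b : Fin τ.yLen → N)
      (realizes : τ.formula.Realize (Sum.elim (f ∘ g ∘ a) b))
      (carrier_eq : Set.range f = Set.range (f ∘ g) ∪ Set.range b)
      (V_eq : ∀ β, S'.V β = g '' S.V β ∪ {y | τ.level.next ≤ β ∧ f y ∈ Set.range b}) :
      WitnessStep T τ S a S' g
  | stuck (h : ¬ S.HasWitness τ a)
      (h' : ¬ ∃ (N : Theory.ModelType.{0, 0, 0} T) (f : S ↪[L] N) (b : Fin τ.yLen → N),
        τ.formula.Realize (Sum.elim (f ∘ a) b)) :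
      WitnessStep T τ S a S (Embedding.refl L S)

/-- Treat the tuples of a list one after the other, for a fixed pair `τ`. -/
inductive Sweep (T : L.Theory) (τ : Task L) :
    (S : Stage L) → List (Fin τ.xLen → S) → Stage L → Prop
  | nil (S : Stage L) : Sweep T τ S [] S
  | cons (S : Stage L) (a : Fin τ.xLen → S) (l : List (Fin τ.xLen → S)) (S' : Stage L)
      (g : S ↪[L] S') (S'' : Stage L) (head : WitnessStep T τ S a S' g)
      (tail : Sweep T τ S' (l.map fun c => g ∘ c) S'') : Sweep T τ S (a :: l) S''

/-- Treat a list of pairs one after the other; for a pair `(φ, α)`, one enumerates all the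
tuples from `V_α` of the current structure and treats each of them. -/
inductive Treat (T : L.Theory) : Stage L → List (Task L) → Stage L → Prop
  | nil (S : Stage L) : Treat T S [] S
  | cons (S : Stage L) (τ : Task L) (ts : List (Task L)) (l : List (Fin τ.xLen → S))
      (S' S'' : Stage L) (nodup : l.Nodup) (mem_iff : ∀ a, a ∈ l ↔ ∀ i, a i ∈ S.V τ.level)
      (head : Sweep T τ S l S') (tail : Treat T S' ts S'') : Treat T S (τ :: ts) S''

/-- The data of the construction: an enumeration `σ` of order type `ω` of the pairs `(φ, α)` in
which each pair appears infinitely often, and a sequence `M 0, M 1, …` of finite structures that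
arises as follows. `M 0` is a one-element substructure of a model of `T` whose element lies in
every `V_α`; and `M (n + 1)` is obtained from `M n` by treating `σ 0, …, σ n`, rearranged in such a
way that their levels are nondecreasing. -/
structure Construction (T : L.Theory) where
  σ : ℕ → Task L
  frequently : ∀ τ : Task L, ∃ᶠ i in atTop, σ i = τ
  M : ℕ → Stage L
  subsingleton_zero : Subsingleton (M 0)
  V_zero : ∀ α, (M 0).V α = Set.univ
  embeds_zero : ∃ N : Theory.ModelType.{0, 0, 0} T, Nonempty (M 0 ↪[L] N)
  treat_succ : ∀ n, ∃ ts : List (Task L), ts.Perm ((List.range (n + 1)).map σ) ∧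
    ts.Pairwise (fun τ τ' => τ.level ≤ τ'.level) ∧ Treat T (M n) ts (M (n + 1))

/-! ### The ultraproduct -/

namespace Construction

variable {T : L.Theory} (C : Construction T) (U : Ultrafilter ℕ)

/-- The ultraproduct `M = ∏_U M_n`, with its `L`-structure. -/
abbrev Ultra : Type := (U : Filter ℕ).Product fun n => (C.M n).carrier

/-- The internal subset of `M ^ m` (`M = ∏_U M_n`) given by a sequence of sets `D n ⊆ M_n ^ m`. -/
def internalSet {m : ℕ} (D : ∀ n, Set (Fin m → C.M n)) : Set (Fin m → C.Ultra U) :=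
  {x | ∃ r : Fin m → ∀ n, C.M n, (∀ i, x i = (r i : C.Ultra U)) ∧
    ∀ᶠ n in (U : Filter ℕ), (fun i => r i n) ∈ D n}

/-- The interpretation `V_α^M` of `V_α` in the ultraproduct `M`. -/
def V (α : Level) : Set (C.Ultra U) :=
  {x | ∃ r : ∀ n, C.M n, x = (r : C.Ultra U) ∧ ∀ᶠ n in (U : Filter ℕ), r n ∈ (C.M n).V α}

/-- The set `V_{<ω}^M`, the union of the `V_n^M` for `n < ω`. -/
def VltOmega : Set (C.Ultra U) := ⋃ n : ℕ, C.V U (Level.fin n)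

/-- The set `V_ω^M`. -/
def VOmega : Set (C.Ultra U) := C.V U (Level.omegaAdd 0)

/-- The substructure `M'` of `M` with universe the union of the `V_{ω+n}^M` for `n < ω`
(the language is relational, so that every subset is a substructure). -/
def M' [L.IsRelational] : L.Substructure (C.Ultra U) where
  carrier := ⋃ n : ℕ, C.V U (Level.omegaAdd n)
  fun_mem := fun f => isEmptyElim f

end Construction

/-! ### Types and dividing -/

/-- `b` and `c` have the same type over `a` in the structure `N`. -/
def SameTypeOver {N : Type} [L.Structure N] {p q : ℕ} (a : Fin p → N) (b c : Fin q → N) : Prop :=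
  ∀ χ : L.Formula (Fin q ⊕ Fin p), χ.Realize (Sum.elim b a) ↔ χ.Realize (Sum.elim c a)

/-- `φ(x, b)` divides over `a`, where `a`, `b` are tuples from `N`: in some elementary extension
of `N` there are realizations `c 0, c 1, …` of the type of `b` over `a` such that
`{φ(x, c i) : i < ω}` is `k`-inconsistent for some `k ≥ 1`. -/
def DividesOver {N : Type} [L.Structure N] {m p q : ℕ} (φ : L.Formula (Fin m ⊕ Fin q))
    (b : Fin q → N) (a : Fin p → N) : Prop :=
  ∃ (N' : Type) (_ : L.Structure N') (j : N ↪ₑ[L] N') (k : ℕ) (c : ℕ → Fin q → N'),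
    0 < k ∧ (∀ i, SameTypeOver (L := L) (j ∘ a) (c i) (j ∘ b)) ∧
    ∀ s : Finset ℕ, s.card = k →
      ¬ ∃ x : Fin m → N', ∀ i ∈ s, φ.Realize (Sum.elim x (c i))

/-! ### The fine pseudofinite dimension -/

/-- The convex hull of `ℤ` in the ultrapower `ℝ^* = ∏_U ℝ`. -/
def finiteReals (U : Ultrafilter ℕ) : AddSubgroup ((U : Filter ℕ).Germ ℝ) where
  carrier := {x | ∃ m n : ℤ, (m : (U : Filter ℕ).Germ ℝ) ≤ x ∧ x ≤ (n : (U : Filter ℕ).Germ ℝ)}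
  zero_mem' := ⟨0, 0, by simp, by simp⟩
  add_mem' := by
    rintro x y ⟨m, n, h1, h2⟩ ⟨m', n', h1', h2'⟩
    exact ⟨m + m', n + n', by push_cast; exact add_le_add h1 h1',
      by push_cast; exact add_le_add h2 h2'⟩
  neg_mem' := by
    rintro x ⟨m, n, h1, h2⟩
    exact ⟨-n, -m, by push_cast; exact neg_le_neg h2, by push_cast; exact neg_le_neg h1⟩

/-- The quotient of `ℝ^*` by the convex hull of `ℤ`. -/
def DimGroup (U : Ultrafilter ℕ) : Type := (U : Filter ℕ).Germ ℝ ⧸ finiteReals U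

/-- The quotient map onto `DimGroup U`. -/
def DimGroup.mk {U : Ultrafilter ℕ} (x : (U : Filter ℕ).Germ ℝ) : DimGroup U :=
  QuotientAddGroup.mk x

theorem DimGroup.mk_surjective {U : Ultrafilter ℕ} :
    Function.Surjective (DimGroup.mk (U := U)) := QuotientAddGroup.mk_surjective

theorem DimGroup.mk_eq_mk {U : Ultrafilter ℕ} {x y : (U : Filter ℕ).Germ ℝ} :
    DimGroup.mk x = DimGroup.mk y ↔ y - x ∈ finiteReals U := by
  rw [sub_eq_neg_add]
  exact QuotientAddGroup.eq

/-- The order on the quotient induced by the order of `ℝ^*`. -/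
noncomputable instance (U : Ultrafilter ℕ) : LinearOrder (DimGroup U) where
  le X Y := ∃ x y, DimGroup.mk x = X ∧ DimGroup.mk y = Y ∧ x ≤ y
  le_refl X := by
    obtain ⟨x, rfl⟩ := DimGroup.mk_surjective X
    exact ⟨x, x, rfl, rfl, le_rfl⟩
  le_trans := by
    rintro X Y Z ⟨x, y, rfl, rfl, h⟩ ⟨y', z, hy, rfl, h'⟩
    refine ⟨x, z + (y - y'), rfl, ?_, by linarith⟩
    rw [DimGroup.mk_eq_mk] at hy ⊢
    have := (finiteReals U).neg_mem hy
    rwa [show z - (z + (y - y')) = -(y - y') by ring]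
  le_antisymm := by
    rintro X Y ⟨x, y, rfl, rfl, h⟩ ⟨y', x', hy, hx, h'⟩
    rw [DimGroup.mk_eq_mk] at hy hx ⊢
    obtain ⟨-, n, -, hn⟩ := (finiteReals U).sub_mem hy hx
    exact ⟨0, n, by push_cast; linarith, by linarith⟩
  le_total := by
    intro X Y
    obtain ⟨x, rfl⟩ := DimGroup.mk_surjective X
    obtain ⟨y, rfl⟩ := DimGroup.mk_surjective Y
    rcases le_total x y with h | h
    · exact Or.inl ⟨x, y, rfl, rfl, h⟩
    · exact Or.inr ⟨y, x, rfl, rfl, h⟩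
  toDecidableLE := Classical.decRel _

namespace Construction

variable {T : L.Theory} (C : Construction T) (U : Ultrafilter ℕ)

/-- A sequence of sets is determined by its internal set up to a `U`-small set of indices. -/
theorem eventually_eq_of_internalSet_eq {m : ℕ} {D E : ∀ n, Set (Fin m → C.M n)}
    (h : C.internalSet U D = C.internalSet U E) : ∀ᶠ n in (U : Filter ℕ), D n = E n := by
  classical
  have key : ∀ D E : ∀ n, Set (Fin m → C.M n), C.internalSet U D = C.internalSet U E →
      ∀ᶠ n in (U : Filter ℕ), D n ⊆ E n := by
    intro D E h
    by_contra hne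
    rw [← Ultrafilter.eventually_not] at hne
    let r : ∀ n, Fin m → C.M n := fun n =>
      Classical.epsilon fun y : Fin m → C.M n => y ∈ D n ∧ y ∉ E n
    have hr : ∀ᶠ n in (U : Filter ℕ), r n ∈ D n ∧ r n ∉ E n := by
      filter_upwards [hne] with n hn
      obtain ⟨y, hy, hy'⟩ := Set.not_subset.1 hn
      exact Classical.epsilon_spec (p := fun y => y ∈ D n ∧ y ∉ E n) ⟨y, hy, hy'⟩
    have hD : (fun i => ((fun n => r n i : ∀ n, C.M n) : C.Ultra U)) ∈ C.internalSet U D :=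
      ⟨fun i n => r n i, fun _ => rfl, hr.mono fun _ h => h.1⟩
    rw [h] at hD
    obtain ⟨s, hs, hsE⟩ := hD
    have hrs : ∀ᶠ n in (U : Filter ℕ), ∀ i, r n i = s i n :=
      eventually_all.2 fun i => Quotient.exact (hs i)
    obtain ⟨n, h1, h2, h3⟩ := (hr.and (hsE.and hrs)).exists
    exact h1.2 (by rwa [show r n = fun i => s i n from funext h3])
  filter_upwards [key D E h, key E D h.symm] with n h1 h2 using h1.antisymm h2

open Classical in
/-- The nonstandard cardinality `|X| ∈ ℝ^*` of an internal (for instance, definable) set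
`X ⊆ M ^ m`: the class of the sequence `|D n|`, if `X` is given by the sequence `D`. -/
noncomputable def starCard {m : ℕ} (X : Set (Fin m → C.Ultra U)) : (U : Filter ℕ).Germ ℝ :=
  if h : ∃ D, X = C.internalSet U D then
    ((fun n => ((h.choose n).ncard : ℝ) : ℕ → ℝ) : (U : Filter ℕ).Germ ℝ)
  else 0

theorem starCard_internalSet {m : ℕ} (D : ∀ n, Set (Fin m → C.M n)) :
    C.starCard U (C.internalSet U D) =
      ((fun n => ((D n).ncard : ℝ) : ℕ → ℝ) : (U : Filter ℕ).Germ ℝ) := by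
  have h : ∃ E, C.internalSet U D = C.internalSet U E := ⟨D, rfl⟩
  rw [starCard, dif_pos h]
  refine Germ.coe_eq.2 ?_
  filter_upwards [C.eventually_eq_of_internalSet_eq U h.choose_spec] with n hn
  rw [← hn]

open Classical in
/-- The fine pseudofinite dimension `δ_M(X)`: the class of `log |X|` modulo the convex hull of
`ℤ`, and `-∞` if `|X| = 0`. -/
noncomputable def delta {m : ℕ} (X : Set (Fin m → C.Ultra U)) : WithBot (DimGroup U) :=
  if C.starCard U X = 0 then ⊥ else ↑(DimGroup.mk ((C.starCard U X).map Real.log))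

/-- The subset of `M ^ m` defined in `M` by `φ_ω(x, b)`, that is, by `φ(x, b) ∧ x ∈ V_ω`. -/
def omegaSet {m q : ℕ} (φ : L.Formula (Fin m ⊕ Fin q)) (b : Fin q → C.Ultra U) :
    Set (Fin m → C.Ultra U) :=
  {x | φ.Realize (Sum.elim x b) ∧ ∀ i, x i ∈ C.VOmega U}

end Construction

end FinePseudofinite

/-! The core is a count. If `φ(x, b)` divides over `a`, with constant `k`, then for every `r` there
are `k(r+1)` tuples, each satisfying a prescribed finite part of the type of `b` over `a`, whose
instances of `φ` are `k`-inconsistent and imply `ψ(x, a)`. If these tuples lie in `V_ω`, then in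
almost every `M_n` the corresponding finite solution sets sit inside that of `ψ`, and every point is
in fewer than `k` of them, so one of them has at most `1/(r+1)` of the points
(`exists_mul_ncard_le`). The type is countable, so saturation (`exists_forall_eventually`) yields
one tuple that works for all `r` and the whole type. A ratio beyond every standard integer is a
strict inequality of dimensions.

What remains is to find witnesses inside `V_ω`. The ultraproduct `M` embeds in a model `N` of `T`.
By Robinson's test a formula and its negation are both existential modulo `T`, and every tuple from
`V_α` is eventually treated for both, so what `N` realizes over a tuple from `V_α^M` is realized in
`V_{α+1}^M` (`exists_realize_of_mem_V`). Hence `M' ≼ N`, and over `V_{<ω}` witnesses can be taken in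
`V_ω` (`exists_mem_VOmega`). Since `M' ⊆ M ⊆ N`, existential formulas agree in `M` and `M'` on
tuples of `M'`; this links the sets counted in `M` to dividing and implication in `M'`. -/

namespace FinePseudofinite

variable {L : FirstOrder.Language.{0, 0}}

/-! ### Compactness and Robinson's test -/

theorem _root_.FirstOrder.Language.BoundedFormula.IsQF.restrictFreeVar {α β : Type} [DecidableEq α]
    {n : ℕ} {φ : L.BoundedFormula α n} (h : φ.IsQF) (f : φ.freeVarFinset → β) :
    (φ.restrictFreeVar f).IsQF := by
  induction h with
  | falsum => exact BoundedFormula.IsQF.falsum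
  | of_isAtomic h =>
    cases h with
    | equal t₁ t₂ => exact BoundedFormula.IsQF.of_isAtomic (BoundedFormula.IsAtomic.equal _ _)
    | rel R ts => exact BoundedFormula.IsQF.of_isAtomic (BoundedFormula.IsAtomic.rel _ _)
  | imp _ _ ih₁ ih₂ => exact BoundedFormula.IsQF.imp (ih₁ _) (ih₂ _)

theorem _root_.FirstOrder.Language.BoundedFormula.IsQF.foldr_inf {α : Type} {n : ℕ}
    (l : List (L.BoundedFormula α n)) (h : ∀ φ ∈ l, φ.IsQF) :
    (l.foldr (· ⊓ ·) ⊤).IsQF := by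
  induction l with
  | nil => exact BoundedFormula.IsQF.top
  | cons φ l ih =>
    exact (h φ (by simp)).inf (ih fun ψ hψ => h ψ (by simp [hψ]))

theorem _root_.FirstOrder.Language.BoundedFormula.IsQF.iInf {α β : Type} [Finite β] {n : ℕ}
    {f : β → L.BoundedFormula α n} (h : ∀ b, (f b).IsQF) : (BoundedFormula.iInf f).IsQF := by
  refine BoundedFormula.IsQF.foldr_inf _ fun φ hφ => ?_
  obtain ⟨b, -, rfl⟩ := List.mem_map.1 hφ
  exact h b

/-- Compactness for formulas with free variables. -/
theorem exists_finset_of_entails (T : L.Theory) {α : Type} (Φ : Set (L.Formula α))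
    (χ : L.Formula α)
    (h : ∀ (N : Theory.ModelType.{0, 0, 0} T) (v : α → N), (∀ φ ∈ Φ, φ.Realize v) → χ.Realize v) :
    ∃ F : Finset (L.Formula α), (F : Set (L.Formula α)) ⊆ Φ ∧
      ∀ (N : Theory.ModelType.{0, 0, 0} T) (v : α → N),
        (∀ φ ∈ F, φ.Realize v) → χ.Realize v := by
  classical
  have key : ((L.lhomWithConstants α).onTheory T ∪ Formula.equivSentence '' Φ) ⊨ᵇ
      Formula.equivSentence χ := by
    refine Theory.models_sentence_iff.2 fun A => ?_
    let := (L.lhomWithConstants α).reduct A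
    have hA := A.is_model
    rw [Theory.model_union_iff] at hA
    have : A ⊨ T := (LHom.onTheory_model _ _).1 hA.1
    rw [Formula.realize_equivSentence]
    refine h (Theory.ModelType.of T A) (fun a => (L.con a : A)) fun φ hφ => ?_
    have := hA.2.realize_of_mem _ (Set.mem_image_of_mem Formula.equivSentence hφ)
    rwa [Formula.realize_equivSentence] at this
  obtain ⟨T₀, hT₀, hχ⟩ := Theory.models_iff_finset_models.1 key
  refine ⟨(T₀.preimage Formula.equivSentence Formula.equivSentence.injective.injOn).filter (· ∈ Φ),
    fun φ hφ => (Finset.mem_filter.1 hφ).2, fun N v hv => ?_⟩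
  let : (constantsOn α).Structure N := constantsOn.structure v
  have : N ⊨ (L.lhomWithConstants α).onTheory T := (LHom.onTheory_model _ _).2 inferInstance
  have hN : N ⊨ (T₀ : L[[α]].Theory) := by
    refine ⟨fun s hs => ?_⟩
    rcases hT₀ hs with h' | ⟨φ, hφ, rfl⟩
    · exact this.realize_of_mem _ h'
    · exact (Formula.realize_equivSentence _ _).2 (hv φ (by simp [hφ]; exact hs))
  exact (Formula.realize_equivSentence _ _).1 (hχ.realize_sentence N)

/-- Modulo `T`, the formula `χ` is equivalent to an existential one. -/
def IsExistentialMod (T : L.Theory) {α : Type} (χ : L.Formula α) : Prop :=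
  ∃ (k : ℕ) (θ : L.Formula (α ⊕ Fin k)), θ.IsQF ∧
    ∀ (N : Theory.ModelType.{0, 0, 0} T) (v : α → N),
      χ.Realize v ↔ ∃ y, θ.Realize (Sum.elim v y)

theorem IsExistentialMod.bot (T : L.Theory) {α : Type} :
    IsExistentialMod T (⊥ : L.Formula α) :=
  ⟨0, ⊥, BoundedFormula.isQF_bot, fun N v => by simp [Formula.Realize]⟩

theorem IsExistentialMod.sup {T : L.Theory} {α : Type} {χ χ' : L.Formula α}
    (h : IsExistentialMod T χ) (h' : IsExistentialMod T χ') : IsExistentialMod T (χ ⊔ χ') := by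
  obtain ⟨k, θ, hθ, hχ⟩ := h
  obtain ⟨k', θ', hθ', hχ'⟩ := h'
  let e : L.Formula (α ⊕ Fin (k + k')) := θ.relabel (Sum.map id (Fin.castAdd k'))
  let e' : L.Formula (α ⊕ Fin (k + k')) := θ'.relabel (Sum.map id (Fin.natAdd k))
  refine ⟨k + k', e ⊔ e', BoundedFormula.IsQF.sup (hθ.relabel _) (hθ'.relabel _), fun N v => ?_⟩
  have h₁ : ∀ y : Fin (k + k') → N,
      e.Realize (Sum.elim v y) ↔ θ.Realize (Sum.elim v (y ∘ Fin.castAdd k')) := fun y => by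
    simp only [e, Formula.realize_relabel, Sum.elim_comp_map, Function.comp_id]
  have h₂ : ∀ y : Fin (k + k') → N,
      e'.Realize (Sum.elim v y) ↔ θ'.Realize (Sum.elim v (y ∘ Fin.natAdd k)) := fun y => by
    simp only [e', Formula.realize_relabel, Sum.elim_comp_map, Function.comp_id]
  obtain ⟨z⟩ : Nonempty N := inferInstance
  simp only [Formula.realize_sup, hχ, hχ', h₁, h₂, exists_or]
  refine or_congr ⟨fun ⟨y, hy⟩ => ⟨Fin.append y fun _ => z, ?_⟩, fun ⟨y, hy⟩ => ⟨_, hy⟩⟩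
    ⟨fun ⟨y, hy⟩ => ⟨Fin.append (fun _ => z) y, ?_⟩, fun ⟨y, hy⟩ => ⟨_, hy⟩⟩
  · convert hy using 2; ext i; simp
  · convert hy using 2; ext i; simp

theorem IsModelComplete.realize_iff {T : L.Theory} (hT : IsModelComplete T) {α : Type} [Finite α]
    (A B : Theory.ModelType.{0, 0, 0} T) (f : A ↪[L] B) (χ : L.Formula α) (x : α → A) :
    χ.Realize (f ∘ x) ↔ χ.Realize x := by
  obtain ⟨n, ⟨e⟩⟩ := Finite.exists_equiv_fin α
  have := hT A B f n (χ.relabel e) (x ∘ e.symm)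
  simpa only [Formula.realize_relabel, Function.comp_assoc, Equiv.symm_comp_self,
    Function.comp_id] using this

/-- A model of `T` satisfying the quantifier-free diagram of `A` extends `A`, elementarily by model
completeness, so it satisfies `χ(c)`. By compactness a finite part of the diagram suffices;
quantifying out its parameters gives the existential formula. -/
theorem exists_existential_below {T : L.Theory} (hT : IsModelComplete T) {α : Type} [Finite α]
    (χ : L.Formula α) (A : Theory.ModelType.{0, 0, 0} T) (c : α → A) (hc : χ.Realize c) :
    ∃ η : L.Formula α, IsExistentialMod T η ∧ η.Realize c ∧
      ∀ (N : Theory.ModelType.{0, 0, 0} T) (v : α → N), η.Realize v → χ.Realize v := by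
  classical
  obtain ⟨F, hF, hFχ⟩ := exists_finset_of_entails T
    {θ : L.Formula A | θ.IsQF ∧ θ.Realize id} (χ.relabel c) (by
      intro N v hv
      have hqf : ∀ θ : L.Formula A, θ.IsQF → (θ.Realize v ↔ θ.Realize id) := by
        intro θ hθ
        refine ⟨fun h => ?_, fun h => hv θ ⟨hθ, h⟩⟩
        by_contra h'
        exact Formula.realize_not.1 (hv θ.not ⟨hθ.not, Formula.realize_not.2 h'⟩) h
      have hinj : Function.Injective v := by
        intro x y hxy
        have := hqf (Term.equal (.var x) (.var y)) (BoundedFormula.IsAtomic.equal _ _).isQF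
        simpa [hxy] using this
      let f : A ↪[L] N :=
        { toFun := v
          inj' := hinj
          map_fun' := by
            intro n g x
            have := hqf (Term.equal (.func g fun i => .var (x i)) (.var (Structure.funMap g x)))
              (BoundedFormula.IsAtomic.equal _ _).isQF
            simpa [Function.comp_def, eq_comm] using this
          map_rel' := by
            intro n R x
            have := hqf (R.formula fun i => .var (x i)) (BoundedFormula.IsAtomic.rel _ _).isQF
            simpa [Formula.realize_rel, Function.comp_def] using this }
      rw [Formula.realize_relabel]
      exact (hT.realize_iff A N f χ c).2 hc)
  let δ : L.Formula A := BoundedFormula.iInf fun φ : F => (φ : L.Formula A)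
  have hδ : δ.IsQF := BoundedFormula.IsQF.iInf fun φ => (hF φ.2).1
  have hδr : ∀ (N : Theory.ModelType.{0, 0, 0} T) (v : A → N),
      δ.Realize v ↔ ∀ φ ∈ F, φ.Realize v := fun N v => by
    simp only [δ, Formula.Realize, BoundedFormula.realize_iInf, Subtype.forall]
  have := Fintype.ofFinite α
  -- The entries of `c` are included even if they do not occur in `δ`, so that `θ₁` can tie the free
  -- variables to them.
  let s : Finset A := δ.freeVarFinset ∪ Finset.univ.image c
  have hs : ∀ i, c i ∈ s := fun i => by simp [s]
  obtain ⟨k, ⟨e⟩⟩ := Finite.exists_equiv_fin s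
  let θ₀ : L.Formula (α ⊕ Fin k) :=
    BoundedFormula.restrictFreeVar δ fun x => Sum.inr (e ⟨x, Finset.mem_union_left _ x.2⟩)
  let θ₁ : L.Formula (α ⊕ Fin k) :=
    BoundedFormula.iInf fun i : α => Term.equal (.var (.inl i)) (.var (.inr (e ⟨c i, hs i⟩)))
  have hθ₁ : ∀ (N : Theory.ModelType.{0, 0, 0} T) (x : α → N) (y : Fin k → N),
      θ₁.Realize (Sum.elim x y) ↔ ∀ i, x i = y (e ⟨c i, hs i⟩) := fun N x y => by
    change Formula.Realize (Formula.iInf _) _ ↔ _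
    simp [Formula.realize_iInf, Formula.realize_equal]
  have hθ₀ : ∀ (N : Theory.ModelType.{0, 0, 0} T) (x : α → N) (y : Fin k → N) (v : A → N),
      (∀ a : s, y (e a) = v a) → (θ₀.Realize (Sum.elim x y) ↔ δ.Realize v) := fun N x y v hv =>
    BoundedFormula.realize_restrictFreeVar v fun a => hv ⟨a, Finset.mem_union_left _ a.2⟩
  let θ : L.Formula (α ⊕ Fin k) := θ₀ ⊓ θ₁
  have hθ : θ.IsQF := BoundedFormula.IsQF.inf (hδ.restrictFreeVar _)
    (BoundedFormula.IsQF.iInf fun i => (BoundedFormula.IsAtomic.equal _ _).isQF)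
  refine ⟨θ.iExs (Fin k), ⟨k, θ, hθ, fun N v => Formula.realize_iExs⟩,
    Formula.realize_iExs.2 ⟨fun i => e.symm i, Formula.realize_inf.2 ⟨?_, ?_⟩⟩, fun N x hx => ?_⟩
  · exact (hθ₀ A _ _ id fun a => by simp).2 ((hδr A _).2 fun φ hφ => (hF hφ).2)
  · exact (hθ₁ A _ _).2 fun i => by simp
  · obtain ⟨y, hy⟩ := Formula.realize_iExs.1 hx
    obtain ⟨h₀, h₁⟩ := Formula.realize_inf.1 hy
    obtain ⟨z⟩ : Nonempty N := inferInstance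
    -- Elements outside `s` do not occur in `δ`, so their value `z` is arbitrary.
    let v : A → N := fun a => if h : a ∈ s then y (e ⟨a, h⟩) else z
    have hv : δ.Realize v := (hθ₀ N x y v fun a => by simp [v]).1 h₀
    have := hFχ N v ((hδr N v).1 hv)
    rw [Formula.realize_relabel] at this
    convert this using 1
    ext i
    rw [(hθ₁ N x y).1 h₁ i]
    simp [v, hs]

/-- Robinson's test: modulo a model complete theory, every formula is existential. -/
theorem IsModelComplete.isExistentialMod {T : L.Theory} (hT : IsModelComplete T) {α : Type}
    [Finite α] (χ : L.Formula α) : IsExistentialMod T χ := by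
  let D : Set (L.Formula α) := {η | IsExistentialMod T η ∧
    ∀ (N : Theory.ModelType.{0, 0, 0} T) (v : α → N), η.Realize v → χ.Realize v}
  obtain ⟨F, hF, hFχ⟩ := exists_finset_of_entails T (Formula.not '' D) χ.not (by
    intro N v hv
    rw [Formula.realize_not]
    intro hχ
    obtain ⟨η, hη, hηv, hηχ⟩ := exists_existential_below hT χ N v hχ
    exact Formula.realize_not.1 (hv _ ⟨η, ⟨hη, hηχ⟩, rfl⟩) hηv)
  -- `D` is closed under finite disjunctions, so finitely many members can be replaced by a single
  -- one.
  have key : ∀ F : Finset (L.Formula α), (F : Set (L.Formula α)) ⊆ Formula.not '' D →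
      ∃ η ∈ D, ∀ (N : Theory.ModelType.{0, 0, 0} T) (v : α → N),
        ¬ η.Realize v → ∀ φ ∈ F, φ.Realize v := by
    classical
    intro F
    induction F using Finset.induction_on with
    | empty => exact fun _ => ⟨⊥, ⟨.bot T, fun N v h => by simp [Formula.Realize] at h⟩, by simp⟩
    | insert φ F _ ih =>
      intro h
      rw [Finset.coe_insert, Set.insert_subset_iff] at h
      obtain ⟨⟨η', hη', rfl⟩, h⟩ := h
      obtain ⟨η, hη, H⟩ := ih h
      refine ⟨η ⊔ η', ⟨hη.1.sup hη'.1, fun N v hv => ?_⟩, fun N v hv => ?_⟩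
      · exact (Formula.realize_sup.1 hv).elim (hη.2 N v) (hη'.2 N v)
      · rw [Formula.realize_sup, not_or] at hv
        intro φ hφ
        rcases Finset.mem_insert.1 hφ with rfl | hφ
        · exact Formula.realize_not.2 hv.2
        · exact H N v hv.1 φ hφ
  obtain ⟨η, ⟨⟨k, θ, hθ, hηθ⟩, hηχ⟩, H⟩ := key F hF
  refine ⟨k, θ, hθ, fun N v => ⟨fun h => ?_, fun h => hηχ N v ((hηθ N v).2 h)⟩⟩
  rw [← hηθ N v]
  by_contra hη
  exact Formula.realize_not.1 (hFχ N v (H N v hη)) h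

/-! ### What the finite construction achieves -/

theorem _root_.FirstOrder.Language.BoundedFormula.IsQF.formula_realize_comp {α : Type}
    {A B : Type} [L.Structure A] [L.Structure B] {φ : L.Formula α}
    (h : φ.IsQF) (f : A ↪[L] B) (v : α → A) : φ.Realize (f ∘ v) ↔ φ.Realize v := by
  rw [Formula.Realize, Formula.Realize, ← h.realize_embedding f,
    Subsingleton.elim (f ∘ (default : Fin 0 → A)) default]

/-- `S` embeds in a model of `T`. -/
def Stage.EmbedsInModel (T : L.Theory) (S : Stage L) : Prop :=
  ∃ N : Theory.ModelType.{0, 0, 0} T, Nonempty (S ↪[L] N)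

/-- The tuple `a` needs no further treatment for `τ`, in `S` and its extensions. -/
def Stage.IsTreated (T : L.Theory) (S : Stage L) (τ : Task L) (a : Fin τ.xLen → S) : Prop :=
  S.HasWitness τ a ∨
    ¬ ∃ (N : Theory.ModelType.{0, 0, 0} T) (f : S ↪[L] N) (b : Fin τ.yLen → N),
        τ.formula.Realize (Sum.elim (f ∘ a) b)

/-- `g` respects the predicates `V_β`, and `S'` has no new elements of level at most `α`. -/
structure Stage.IsEndExtension (α : Level) {S S' : Stage L} (g : S ↪[L] S') : Prop where
  image_subset : ∀ β, g '' S.V β ⊆ S'.V β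
  eq_image : ∀ β ≤ α, S'.V β = g '' S.V β

theorem Level.lt_next (α : Level) : α < α.next := by
  obtain ⟨b, n⟩ := α
  exact Prod.Lex.toLex_lt_toLex.2 (Or.inr ⟨rfl, Nat.lt_succ_self n⟩)

theorem Stage.HasWitness.map {S S' : Stage L} {τ : Task L} {a : Fin τ.xLen → S}
    (h : S.HasWitness τ a) {g : S ↪[L] S'} (hg : ∀ β, g '' S.V β ⊆ S'.V β) :
    S'.HasWitness τ (g ∘ a) := by
  obtain ⟨b, hb, hφ⟩ := h
  refine ⟨g ∘ b, fun j => hg _ ⟨b j, hb j, rfl⟩, ?_⟩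
  rwa [← Sum.comp_elim, τ.isQF.formula_realize_comp]

/-- Old witnesses survive because `φ` is quantifier-free, and a model extending `S'` also extends
`S`, so an impossible task stays impossible. -/
theorem Stage.IsTreated.map {T : L.Theory} {S S' : Stage L} {τ : Task L} {a : Fin τ.xLen → S}
    (h : S.IsTreated T τ a) {g : S ↪[L] S'} (hg : ∀ β, g '' S.V β ⊆ S'.V β) :
    S'.IsTreated T τ (g ∘ a) :=
  h.imp (fun h => h.map hg) fun h ⟨N, f, b, hb⟩ => h ⟨N, f.comp g, b, hb⟩

theorem Stage.IsEndExtension.refl (α : Level) (S : Stage L) :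
    Stage.IsEndExtension α (Embedding.refl L S) :=
  ⟨fun β => (Set.image_id (S.V β)).le, fun β _ => (Set.image_id (S.V β)).symm⟩

theorem Stage.IsEndExtension.comp {α : Level} {S S' S'' : Stage L} {g : S ↪[L] S'}
    {g' : S' ↪[L] S''} (h' : Stage.IsEndExtension α g') (h : Stage.IsEndExtension α g) :
    Stage.IsEndExtension α (g'.comp g) := by
  have key : ∀ s, g'.comp g '' s = g' '' (g '' s) := fun s => by
    rw [← Set.image_comp]; rfl
  refine ⟨fun β => ?_, fun β hβ => ?_⟩
  · rw [key]
    exact (Set.image_mono (h.image_subset β)).trans (h'.image_subset β)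
  · rw [key, h'.eq_image β hβ, h.eq_image β hβ]

theorem Stage.IsEndExtension.mono {α α' : Level} (hα : α' ≤ α) {S S' : Stage L} {g : S ↪[L] S'}
    (h : Stage.IsEndExtension α g) : Stage.IsEndExtension α' g :=
  ⟨h.image_subset, fun β hβ => h.eq_image β (hβ.trans hα)⟩

theorem WitnessStep.spec {T : L.Theory} {τ : Task L} {S S' : Stage L} {a : Fin τ.xLen → S}
    {g : S ↪[L] S'} (h : WitnessStep T τ S a S' g) :
    Stage.IsEndExtension τ.level g ∧ (S.EmbedsInModel T → S'.EmbedsInModel T) ∧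
      S'.IsTreated T τ (g ∘ a) := by
  cases h with
  | old h => exact ⟨.refl _ _, id, Or.inl h⟩
  | stuck h h' => exact ⟨.refl _ _, id, Or.inr h'⟩
  | new h S' g N f b realizes carrier_eq V_eq =>
    refine ⟨⟨fun β => ?_, fun β hβ => ?_⟩, fun _ => ⟨N, ⟨f⟩⟩, Or.inl ?_⟩
    · rw [V_eq]
      exact Set.subset_union_left
    · rw [V_eq, Set.union_eq_left]
      exact fun y hy => absurd (hy.1.trans hβ) (not_le.2 τ.level.lt_next)
    · have hb : ∀ j, ∃ y, f y = b j := fun j => by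
        have : b j ∈ Set.range f := carrier_eq ▸ Or.inr ⟨j, rfl⟩
        exact this
      choose y hy using hb
      refine ⟨y, fun j => ?_, ?_⟩
      · rw [V_eq]
        exact Or.inr ⟨le_rfl, j, (hy j).symm⟩
      · rw [← τ.isQF.formula_realize_comp f, Sum.comp_elim, show f ∘ y = b from funext hy]
        exact realizes

theorem Sweep.spec {T : L.Theory} {τ : Task L} {S S' : Stage L} {l : List (Fin τ.xLen → S)}
    (h : Sweep T τ S l S') :
    ∃ g : S ↪[L] S', Stage.IsEndExtension τ.level g ∧
      (S.EmbedsInModel T → S'.EmbedsInModel T) ∧ ∀ a ∈ l, S'.IsTreated T τ (g ∘ a) := by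
  induction h with
  | nil S => exact ⟨Embedding.refl L S, .refl _ _, id, by simp⟩
  | cons S a l S' g S'' head tail ih =>
    obtain ⟨hg, hT, ha⟩ := head.spec
    obtain ⟨g', hg', hT', hl⟩ := ih
    refine ⟨g'.comp g, hg'.comp hg, hT' ∘ hT, fun c hc => ?_⟩
    rcases List.mem_cons.1 hc with rfl | hc
    · exact ha.map hg'.image_subset
    · exact hl _ (List.mem_map_of_mem hc)

/-- This is where nondecreasing levels matter: the tasks after `τ` have level at least that of `τ`,
so they add nothing to its `V_α`. Every tuple of the final `V_α` was therefore already listed when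
`τ` was treated. -/
theorem Treat.spec {T : L.Theory} {S S' : Stage L} {ts : List (Task L)} (h : Treat T S ts S')
    (hts : ts.Pairwise fun τ τ' => τ.level ≤ τ'.level) :
    ∃ g : S ↪[L] S', (∀ β, g '' S.V β ⊆ S'.V β) ∧
      (∀ α, (∀ τ ∈ ts, α ≤ τ.level) → Stage.IsEndExtension α g) ∧
      (S.EmbedsInModel T → S'.EmbedsInModel T) ∧
      ∀ τ ∈ ts, ∀ a : Fin τ.xLen → S', (∀ i, a i ∈ S'.V τ.level) → S'.IsTreated T τ a := by
  induction h with
  | nil S =>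
    exact ⟨Embedding.refl L S, fun β => (Set.image_id (S.V β)).le,
      fun α _ => .refl _ _, id, by simp⟩
  | cons S τ ts l S' S'' nodup mem_iff head tail ih =>
    obtain ⟨hτ, hts⟩ := List.pairwise_cons.1 hts
    obtain ⟨g, hg, hT, hl⟩ := head.spec
    obtain ⟨g', hg', hE', hT', hl'⟩ := ih hts
    refine ⟨g'.comp g, fun β => ?_, fun α hα => ?_, hT' ∘ hT, fun τ' hτ' a ha => ?_⟩
    · rintro _ ⟨x, hx, rfl⟩
      exact hg' β ⟨g x, hg.image_subset β ⟨x, hx, rfl⟩, rfl⟩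
    · exact (hE' α fun τ' h => hα τ' (List.mem_cons_of_mem _ h)).comp
        (hg.mono (hα τ List.mem_cons_self))
    · rcases List.mem_cons.1 hτ' with rfl | hτ'
      · have hback : ∀ i, ∃ x ∈ S.V τ'.level, g' (g x) = a i := fun i => by
          have h₁ := ha i
          rw [(hE' τ'.level hτ).eq_image _ le_rfl, hg.eq_image _ le_rfl] at h₁
          obtain ⟨_, ⟨x, hx, rfl⟩, h⟩ := h₁
          exact ⟨x, hx, h⟩
        choose x hx hxa using hback
        obtain rfl : a = g' ∘ g ∘ x := funext fun i => (hxa i).symm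
        exact (hl x ((mem_iff x).2 hx)).map hg'
      · exact hl' τ' hτ' a ha

namespace Construction

variable {T : L.Theory} (C : Construction T)

theorem embedsInModel (n : ℕ) : (C.M n).EmbedsInModel T := by
  induction n with
  | zero => exact C.embeds_zero
  | succ n ih =>
    obtain ⟨ts, -, hts, h⟩ := C.treat_succ n
    obtain ⟨-, -, -, hT, -⟩ := h.spec hts
    exact hT ih

theorem eventually_isTreated (τ : Task L) : ∀ᶠ n in atTop, ∀ a : Fin τ.xLen → C.M n,
    (∀ i, a i ∈ (C.M n).V τ.level) → (C.M n).IsTreated T τ a := by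
  obtain ⟨i, hi⟩ := (C.frequently τ).exists
  filter_upwards [eventually_gt_atTop i] with n hn
  obtain ⟨n, rfl⟩ := Nat.exists_eq_add_one_of_ne_zero (Nat.ne_zero_of_lt hn)
  obtain ⟨ts, hperm, hts, h⟩ := C.treat_succ n
  obtain ⟨-, -, -, -, hl⟩ := h.spec hts
  exact hl τ (hperm.mem_iff.2 (List.mem_map.2 ⟨i, List.mem_range.2 hn, hi⟩))

/-- A property that is existential modulo `T`, and whose negation is so, too, is decided in
`M n` for all large `n` by witnesses from the next level. -/
theorem eventually_hasWitness_or (τ : Task L) {k : ℕ} {θ : L.Formula (Fin τ.xLen ⊕ Fin k)}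
    (hθ : θ.IsQF) (h : ∀ (N : Theory.ModelType.{0, 0, 0} T) (x : Fin τ.xLen → N),
      (∃ y, τ.formula.Realize (Sum.elim x y)) ∨ ∃ y, θ.Realize (Sum.elim x y)) :
    ∀ᶠ n in atTop, ∀ a : Fin τ.xLen → C.M n, (∀ i, a i ∈ (C.M n).V τ.level) →
      (C.M n).HasWitness τ a ∨ ∃ y : Fin k → C.M n, θ.Realize (Sum.elim a y) := by
  filter_upwards [C.eventually_isTreated τ,
    C.eventually_isTreated ⟨τ.xLen, k, θ, hθ, τ.level⟩] with n h₁ h₂ a ha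
  obtain ⟨N, ⟨f⟩⟩ := C.embedsInModel n
  rcases h N (f ∘ a) with ⟨y, hy⟩ | ⟨y, hy⟩
  · exact Or.inl ((h₁ a ha).resolve_right fun h => h ⟨N, f, y, hy⟩)
  · obtain ⟨z, -, hz⟩ := (h₂ a ha).resolve_right fun h => h ⟨N, f, y, hy⟩
    exact Or.inr ⟨z, hz⟩

end Construction

/-! ### The ultraproduct `M`, its substructure `M'`, and a model of `T` above them -/

theorem Level.fin_mono : Monotone Level.fin := fun _ _ h =>
  Prod.Lex.toLex_le_toLex.2 (Or.inr ⟨rfl, h⟩)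

theorem Level.omegaAdd_mono : Monotone Level.omegaAdd := fun _ _ h =>
  Prod.Lex.toLex_le_toLex.2 (Or.inr ⟨rfl, h⟩)

theorem Level.fin_next_le (m n : ℕ) : (Level.fin m).next ≤ Level.omegaAdd n :=
  Prod.Lex.toLex_le_toLex.2 (Or.inl Bool.false_lt_true)

namespace Construction

variable {T : L.Theory} (C : Construction T) (U : Ultrafilter ℕ)

variable {C U} in
/-- The element of the ultraproduct given by a sequence. -/
def ofSeq (r : ∀ n, C.M n) : C.Ultra U := (r : C.Ultra U)

theorem exists_ofSeq {α : Type} (x : α → C.Ultra U) :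
    ∃ r : α → ∀ n, C.M n, x = fun i => ofSeq (r i) := by
  choose r hr using fun i => Quotient.exists_rep (x i)
  exact ⟨r, funext fun i => (hr i).symm⟩

variable {C U}

theorem ofSeq_mem_V {α : Level} {r : ∀ n, C.M n} :
    ofSeq r ∈ C.V U α ↔ ∀ᶠ n in (U : Filter ℕ), r n ∈ (C.M n).V α := by
  refine ⟨?_, fun h => ⟨r, rfl, h⟩⟩
  rintro ⟨s, h, hs⟩
  have hrs : ∀ᶠ n in (U : Filter ℕ), r n = s n := Quotient.exact h
  filter_upwards [hrs, hs] with n h₁ h₂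
  rwa [h₁]

theorem V_mono {α β : Level} (h : α ≤ β) : C.V U α ⊆ C.V U β := by
  rintro _ ⟨r, rfl, hr⟩
  exact ⟨r, rfl, hr.mono fun n hn => (C.M n).mono h hn⟩

theorem realize_ofSeq {α : Type} {φ : L.Formula α} {r : α → ∀ n, C.M n} :
    φ.Realize (fun i => (ofSeq (r i) : C.Ultra U)) ↔
      ∀ᶠ n in (U : Filter ℕ), φ.Realize fun i => r i n :=
  Ultraproduct.realize_formula_cast φ r

theorem realize_elim_ofSeq {α β : Type} {φ : L.Formula (α ⊕ β)} {r : α → ∀ n, C.M n}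
    {s : β → ∀ n, C.M n} :
    φ.Realize (Sum.elim (fun i => (ofSeq (r i) : C.Ultra U)) fun i => ofSeq (s i)) ↔
      ∀ᶠ n in (U : Filter ℕ), φ.Realize (Sum.elim (fun i => r i n) fun i => s i n) := by
  have h₁ : (Sum.elim (fun i => (ofSeq (r i) : C.Ultra U)) fun i => ofSeq (s i)) =
      fun i => ofSeq (Sum.elim r s i) := by
    ext (i | i) <;> rfl
  have h₂ : ∀ n, (Sum.elim (fun i => r i n) fun i => s i n) = fun i => Sum.elim r s i n := by
    intro n
    ext (i | i) <;> rfl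
  simp only [h₁, h₂, realize_ofSeq]

theorem exists_eventually {α : Type} {P : ∀ n, (α → C.M n) → Prop}
    (h : ∀ᶠ n in (U : Filter ℕ), ∃ x, P n x) :
    ∃ r : α → ∀ n, C.M n, ∀ᶠ n in (U : Filter ℕ), P n fun i => r i n := by
  classical
  have : ∀ n, ∃ x : α → C.M n, (∃ x, P n x) → P n x := fun n => by
    by_cases hn : ∃ x, P n x
    · exact ⟨hn.choose, fun _ => hn.choose_spec⟩
    · exact ⟨fun _ => Classical.arbitrary _, fun h => absurd h hn⟩
  choose x hx using this
  exact ⟨fun i n => x n i, h.mono hx⟩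

variable (C U) in
theorem exists_embedding [L.IsRelational] :
    ∃ N : Theory.ModelType.{0, 0, 0} T, Nonempty (C.Ultra U ↪[L] N) := by
  choose N hN using C.embedsInModel
  let f := fun n => (hN n).some
  have hT : (U : Filter ℕ).Product (fun n => (N n : Type)) ⊨ T :=
    ⟨fun φ hφ => (Ultraproduct.sentence_realize φ).2
      (Eventually.of_forall fun n => (N n).is_model.realize_of_mem φ hφ)⟩
  suffices h : Nonempty (C.Ultra U ↪[L] (U : Filter ℕ).Product fun n => (N n : Type)) from
    ⟨Theory.ModelType.of T ((U : Filter ℕ).Product fun n => (N n : Type)), h⟩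
  let g : C.Ultra U → (U : Filter ℕ).Product fun n => (N n : Type) :=
    Quotient.map' (fun r n => f n (r n)) fun r s h =>
      Eventually.mono (f := (U : Filter ℕ)) h fun n hn => congrArg (f n) hn
  refine ⟨{ toFun := g, inj' := ?_, map_fun' := fun F => isEmptyElim F, map_rel' := ?_ }⟩
  · intro x y
    refine Quotient.inductionOn₂ x y fun r s h => Quotient.sound ?_
    have h' : ∀ᶠ n in (U : Filter ℕ), f n (r n) = f n (s n) := Quotient.exact h
    exact h'.mono fun n hn => (f n).injective hn
  · intro k R x
    obtain ⟨r, rfl⟩ := C.exists_ofSeq U x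
    have h₁ := Ultraproduct.realize_formula_cast (u := U) (M := fun n => (N n : Type))
      (R.formula fun i : Fin k => .var i) fun i n => f n (r i n)
    have h₂ := realize_ofSeq (U := U) (φ := R.formula fun i : Fin k => .var i) (r := r)
    simp only [Formula.realize_rel, Term.realize_var] at h₁ h₂
    exact h₁.trans ((eventually_congr (Eventually.of_forall fun n =>
      (f n).map_rel R fun i => r i n)).trans h₂.symm)

variable (hT : IsModelComplete T) (hU : (U : Filter ℕ) ≤ cofinite)
include hT hU

/-- The existential forms of `ξ` and of the negation of `∃ z, ξ` are both treated at level `α`, so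
almost every `M_n` contains a witness for one of them. Quantifier-free facts pass to `N`, where the
second contradicts `z`; the first supplies `c`. -/
theorem exists_realize_of_mem_V {N : Theory.ModelType.{0, 0, 0} T} (f : C.Ultra U ↪[L] N)
    {p : ℕ} {γ : Type} [Finite γ] (ξ : L.Formula (Fin p ⊕ γ)) {α : Level} {a : Fin p → C.Ultra U}
    (ha : ∀ i, a i ∈ C.V U α) {z : γ → N} (hz : ξ.Realize (Sum.elim (f ∘ a) z)) :
    ∃ c : γ → C.Ultra U, (∀ j, c j ∈ C.V U α.next) ∧ ξ.Realize (Sum.elim (f ∘ a) (f ∘ c)) := by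
  obtain ⟨k, ⟨e⟩⟩ := Finite.exists_equiv_fin γ
  obtain ⟨l, θ, hθ, hξθ⟩ := hT.isExistentialMod ξ
  obtain ⟨l', θ', hθ', hξθ'⟩ := hT.isExistentialMod (ξ.iExs γ).not
  -- The wanted tuple and the auxiliary witnesses of `θ` are merged into the single tuple `y` of a
  -- task.
  let g : (Fin p ⊕ γ) ⊕ Fin l → Fin p ⊕ Fin (k + l) :=
    Sum.elim (Sum.map id (Fin.castAdd l ∘ e)) (Sum.inr ∘ Fin.natAdd k)
  have hg : ∀ {A : Type} (x : Fin p → A) (y : Fin (k + l) → A), Sum.elim x y ∘ g =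
      Sum.elim (Sum.elim x (y ∘ Fin.castAdd l ∘ e)) (y ∘ Fin.natAdd k) := by
    intro A x y
    ext ((i | i) | i) <;> rfl
  let τ : Task L := ⟨p, k + l, θ.relabel g, hθ.relabel _, α⟩
  have hτ : ∀ {A : Type} [L.Structure A] (x : Fin p → A) (y : Fin (k + l) → A),
      τ.formula.Realize (Sum.elim x y) ↔
        θ.Realize (Sum.elim (Sum.elim x (y ∘ Fin.castAdd l ∘ e)) (y ∘ Fin.natAdd k)) := by
    intro A _ x y
    rw [← hg]
    exact Formula.realize_relabel
  have hor : ∀ (N : Theory.ModelType.{0, 0, 0} T) (x : Fin p → N),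
      (∃ y, τ.formula.Realize (Sum.elim x y)) ∨ ∃ y, θ'.Realize (Sum.elim x y) := by
    intro N x
    by_cases hx : ∃ z : γ → N, ξ.Realize (Sum.elim x z)
    · obtain ⟨z, hz⟩ := hx
      obtain ⟨y, hy⟩ := (hξθ N _).1 hz
      refine Or.inl ⟨Fin.append (z ∘ e.symm) y, (hτ _ _).2 ?_⟩
      convert hy using 3
      · ext i; simp
      · ext i; simp
    · exact Or.inr ((hξθ' N x).1 (by rwa [Formula.realize_not, Formula.realize_iExs]))
  obtain ⟨r, rfl⟩ := C.exists_ofSeq U a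
  have ha' : ∀ᶠ n in (U : Filter ℕ), ∀ i, r i n ∈ (C.M n).V α :=
    eventually_all.2 fun i => ofSeq_mem_V.1 (ha i)
  have hU' : (U : Filter ℕ) ≤ atTop := Nat.cofinite_eq_atTop ▸ hU
  have hev : ∀ᶠ n in (U : Filter ℕ), (C.M n).HasWitness τ (fun i => r i n) ∨
      ∃ y : Fin l' → C.M n, θ'.Realize (Sum.elim (fun i => r i n) y) := by
    filter_upwards [ha', hU' (C.eventually_hasWitness_or τ hθ' hor)] with n h₁ h₂
    exact h₂ _ h₁
  rcases Ultrafilter.eventually_or.1 hev with h | h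
  · obtain ⟨s, hs⟩ := exists_eventually h
    have hθs : θ.Realize (f ∘ Sum.elim (Sum.elim (fun i => (ofSeq (r i) : C.Ultra U))
        fun i => ofSeq (s (Fin.castAdd l (e i))))
        fun i => ofSeq (s (Fin.natAdd k i))) := by
      rw [hθ.formula_realize_comp]
      exact (hτ (A := C.Ultra U) _ fun i => ofSeq (s i)).1
        (realize_elim_ofSeq.2 (hs.mono fun n hn => hn.2))
    refine ⟨fun j => ofSeq (s (Fin.castAdd l (e j))), fun j => ofSeq_mem_V.2 (hs.mono fun n hn => hn.1 _),
      (hξθ N _).2 ⟨f ∘ fun i => ofSeq (s (Fin.natAdd k i)), ?_⟩⟩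
    rwa [Sum.comp_elim, Sum.comp_elim] at hθs
  · obtain ⟨s, hs⟩ := exists_eventually h
    rw [← realize_elim_ofSeq, ← hθ'.formula_realize_comp f, Sum.comp_elim] at hs
    have := (hξθ' N _).2 ⟨_, hs⟩
    rw [Formula.realize_not, Formula.realize_iExs] at this
    exact absurd ⟨z, hz⟩ this

variable [L.IsRelational]

/-- Tarski–Vaught: finitely many parameters lie in one `V_{ω+n}`, and a witness appears in
`V_{ω+n+1}`, still inside `M'`. -/
theorem realize_comp_subtype {N : Theory.ModelType.{0, 0, 0} T} (f : C.Ultra U ↪[L] N)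
    {α : Type} (φ : L.Formula α) (v : α → C.M' U) :
    φ.Realize (f ∘ Subtype.val ∘ v) ↔ φ.Realize v := by
  refine ((f.comp (C.M' U).subtype).toElementaryEmbedding ?_).map_formula φ v
  intro n χ x z hz
  let ξ : L.Formula (Fin n ⊕ Fin 1) := BoundedFormula.toFormula χ |>.relabel
    (Sum.elim Empty.elim (Fin.lastCases (Sum.inr 0) Sum.inl))
  have hξ : ∀ (y : Fin n → N) (w : Fin 1 → N), ξ.Realize (Sum.elim y w) ↔
      χ.Realize default (Fin.snoc y (w 0) : Fin (n + 1) → N) := by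
    intro y w
    rw [Formula.realize_relabel, BoundedFormula.realize_toFormula, iff_iff_eq]
    congr 1
    · exact Subsingleton.elim _ _
    · ext i
      refine Fin.lastCases ?_ (fun i => ?_) i <;> simp
  have hx : ∀ i, ∃ n : ℕ, (x i : C.Ultra U) ∈ C.V U (Level.omegaAdd n) := fun i =>
    Set.mem_iUnion.1 (x i).2
  choose k hk using hx
  have hx' : ∀ i, (x i : C.Ultra U) ∈ C.V U (Level.omegaAdd (Finset.univ.sup k)) := fun i =>
    V_mono (Level.omegaAdd_mono (Finset.le_sup (Finset.mem_univ i))) (hk i)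
  obtain ⟨c, hc, hξc⟩ := exists_realize_of_mem_V hT hU f ξ hx' (z := fun _ => z)
    ((hξ _ _).2 hz)
  exact ⟨⟨c 0, Set.mem_iUnion.2 ⟨_, hc 0⟩⟩, (hξ _ _).1 hξc⟩

/-- Over `V_{<ω}`, whatever exists in `M'` exists in `V_ω`. -/
theorem exists_mem_VOmega {p : ℕ} {γ : Type} [Finite γ] (ξ : L.Formula (Fin p ⊕ γ))
    {a : Fin p → C.M' U} (ha : ∀ i, (a i : C.Ultra U) ∈ C.VltOmega U)
    (h : ∃ z : γ → C.M' U, ξ.Realize (Sum.elim a z)) :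
    ∃ z : γ → C.M' U, (∀ j, (z j : C.Ultra U) ∈ C.VOmega U) ∧ ξ.Realize (Sum.elim a z) := by
  obtain ⟨N, ⟨f⟩⟩ := C.exists_embedding U
  obtain ⟨z, hz⟩ := h
  choose k hk using fun i => Set.mem_iUnion.1 (ha i)
  have ha' : ∀ i, (a i : C.Ultra U) ∈ C.V U (Level.fin (Finset.univ.sup k)) := fun i =>
    V_mono (Level.fin_mono (Finset.le_sup (Finset.mem_univ i))) (hk i)
  obtain ⟨c, hc, hξ⟩ := exists_realize_of_mem_V hT hU f ξ ha' (z := f ∘ Subtype.val ∘ z) (by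
    have := (realize_comp_subtype hT hU f ξ (Sum.elim a z)).2 hz
    rwa [Sum.comp_elim, Sum.comp_elim] at this)
  have hc' : ∀ j, c j ∈ C.VOmega U := fun j =>
    V_mono (Level.fin_next_le _ _) (hc j)
  refine ⟨fun j => ⟨c j, Set.mem_iUnion.2 ⟨0, hc' j⟩⟩, hc', ?_⟩
  rw [← realize_comp_subtype hT hU f, Sum.comp_elim, Sum.comp_elim]
  exact hξ

/-- Existential formulas go up along `M' ⊆ M ⊆ N`, and `M' ≼ N` brings them back down. -/
theorem realize_val_iff_of_isExistential {α : Type} {φ : L.Formula α} (hφ : φ.IsExistential)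
    (v : α → C.M' U) : φ.Realize (Subtype.val ∘ v) ↔ φ.Realize v := by
  obtain ⟨N, ⟨f⟩⟩ := C.exists_embedding U
  have key : ∀ {A B : Type} [L.Structure A] [L.Structure B] (g : A ↪[L] B) (w : α → A),
      φ.Realize w → φ.Realize (g ∘ w) := fun g w h => by
    have := hφ.realize_embedding g h
    rwa [Subsingleton.elim (g ∘ default) default] at this
  refine ⟨fun h => ?_, fun h => key (C.M' U).subtype v h⟩
  exact (realize_comp_subtype hT hU f φ v).1 (key f _ h)

/-- The type of a tuple of `M'` is determined by properties that are internal to `M`. -/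
theorem exists_realize_val_iff {α : Type} [Finite α] (χ : L.Formula α) :
    ∃ ε : L.Formula α, ∀ v : α → C.M' U, ε.Realize (Subtype.val ∘ v) ↔ χ.Realize v := by
  obtain ⟨N, ⟨f⟩⟩ := C.exists_embedding U
  obtain ⟨k, θ, hθ, hχ⟩ := hT.isExistentialMod χ
  refine ⟨θ.iExs (Fin k), fun v => ?_⟩
  rw [← realize_comp_subtype hT hU f, hχ, Formula.realize_iExs]
  constructor
  · rintro ⟨y, hy⟩
    refine ⟨f ∘ y, ?_⟩
    rwa [← Sum.comp_elim, hθ.formula_realize_comp]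
  · intro h
    rw [← Formula.realize_iExs, realize_comp_subtype hT hU f, Formula.realize_iExs] at h
    obtain ⟨y, hy⟩ := h
    refine ⟨Subtype.val ∘ y, ?_⟩
    rw [← Sum.comp_elim]
    exact (hθ.formula_realize_comp (C.M' U).subtype _).2 hy

end Construction

/-! ### Counting, saturation and conjugates -/

/-- Among `R` subsets of `P` such that no `k` of them have a common element, some set has at most
`k / R` times as many elements as `P`. -/
theorem exists_mul_ncard_le {X : Type} [Finite X] {R k : ℕ} (hR : 0 < R) (D : Fin R → Set X)
    (P : Set X) (hD : ∀ j, D j ⊆ P)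
    (hk : ∀ s : Finset (Fin R), s.card = k → ¬ ∃ x, ∀ j ∈ s, x ∈ D j) :
    ∃ j, R * (D j).ncard ≤ k * P.ncard := by
  classical
  have := Fintype.ofFinite X
  have hcard : ∀ j, (D j).ncard = ∑ x ∈ P.toFinset, if x ∈ D j then 1 else 0 := fun j => by
    rw [Finset.sum_boole, Set.ncard_eq_toFinset_card']
    simp only [Nat.cast_id]
    congr 1
    ext x
    simpa using fun h => hD j h
  have hsum : ∑ j, (D j).ncard ≤ k * P.ncard := by
    simp_rw [hcard]
    rw [Finset.sum_comm, Set.ncard_eq_toFinset_card' P, mul_comm, ← smul_eq_mul]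
    refine Finset.sum_le_card_nsmul _ _ _ fun x _ => ?_
    rw [Finset.sum_boole, Nat.cast_id]
    by_contra! h
    obtain ⟨s, hs, hsk⟩ := Finset.exists_subset_card_eq h.le
    exact hk s hsk ⟨x, fun j hj => (Finset.mem_filter.1 (hs hj)).2⟩
  by_contra! h
  have := Finset.sum_lt_sum_of_nonempty (s := (Finset.univ : Finset (Fin R)))
    ⟨⟨0, hR⟩, Finset.mem_univ _⟩ fun j _ => h j
  rw [Finset.sum_const, Finset.card_univ, Fintype.card_fin, smul_eq_mul, ← Finset.mul_sum] at this
  exact absurd (Nat.mul_le_mul_left R hsum) (not_le.2 this)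

/-- Countable saturation of ultraproducts over a nonprincipal ultrafilter on `ℕ`. -/
theorem exists_forall_eventually {U : Ultrafilter ℕ} (hU : (U : Filter ℕ) ≤ cofinite)
    {X : ℕ → Type} [∀ n, Nonempty (X n)] {P : ℕ → ∀ n, X n → Prop}
    (hP : ∀ n x r r', r ≤ r' → P r' n x → P r n x)
    (h : ∀ r, ∀ᶠ n in (U : Filter ℕ), ∃ x, P r n x) :
    ∃ x : ∀ n, X n, ∀ r, ∀ᶠ n in (U : Filter ℕ), P r n (x n) := by
  classical
  have key : ∀ n, ∃ x, ∀ r ≤ n, (∃ y, P r n y) → P r n x := fun n => by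
    -- Diagonal choice: at index `n`, meet the strongest satisfiable condition among the first `n +
    -- 1`.
    let g := Nat.findGreatest (fun r => ∃ y, P r n y) n
    by_cases hg : ∃ y, P g n y
    · obtain ⟨x, hx⟩ := hg
      exact ⟨x, fun r hr hy => hP n x r g (Nat.le_findGreatest hr hy) hx⟩
    · exact ⟨Classical.arbitrary _, fun r hr hy =>
        absurd (Nat.findGreatest_spec (P := fun r => ∃ y, P r n y) hr hy) hg⟩
  choose x hx using key
  refine ⟨x, fun r => ?_⟩
  have hr : ∀ᶠ n in (U : Filter ℕ), r ≤ n :=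
    hU (Nat.cofinite_eq_atTop ▸ eventually_ge_atTop r)
  filter_upwards [hr, h r] with n h₁ h₂
  exact hx n r h₁ h₂

theorem DimGroup.mk_lt_mk {U : Ultrafilter ℕ} {x y : (U : Filter ℕ).Germ ℝ}
    (h : ∀ n : ℕ, x + n ≤ y) : DimGroup.mk x < DimGroup.mk y := by
  rw [← not_le]
  rintro ⟨y', x', hy, hx, hle⟩
  rw [DimGroup.mk_eq_mk] at hy hx
  obtain ⟨-, n, -, hn⟩ := (finiteReals U).sub_mem hy hx
  have h₁ := h (n.toNat + 1)
  have h₂ : (n : (U : Filter ℕ).Germ ℝ) ≤ (n.toNat : (U : Filter ℕ).Germ ℝ) := by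
    exact_mod_cast Int.self_le_toNat n
  push_cast at h₁
  linarith

/-- The formula `⋀ j, χ(z j, a)`, together with the statement that no `k` of the `R` formulas
`φ(x, z j)` have a common solution. -/
noncomputable def conjugatesFormula {m p q : ℕ} (φ : L.Formula (Fin m ⊕ Fin q))
    (χ : L.Formula (Fin q ⊕ Fin p)) (R k : ℕ) : L.Formula (Fin p ⊕ (Fin R × Fin q)) :=
  Formula.iInf (fun j : Fin R => χ.relabel (Sum.elim (fun t => Sum.inr (j, t)) Sum.inl)) ⊓
    Formula.iInf (fun s : {s : Finset (Fin R) // s.card = k} =>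
      (Formula.iExs (Fin m) (Formula.iInf fun i : s.1 =>
        φ.relabel (Sum.elim Sum.inr fun t => Sum.inl (Sum.inr (i.1, t))))).not)

theorem realize_conjugatesFormula {m p q : ℕ} {φ : L.Formula (Fin m ⊕ Fin q)}
    {χ : L.Formula (Fin q ⊕ Fin p)} {R k : ℕ} {N : Type} [L.Structure N] {a : Fin p → N}
    {z : Fin R × Fin q → N} :
    (conjugatesFormula φ χ R k).Realize (Sum.elim a z) ↔
      (∀ j, χ.Realize (Sum.elim (fun t => z (j, t)) a)) ∧
      ∀ s : Finset (Fin R), s.card = k →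
        ¬ ∃ x : Fin m → N, ∀ i ∈ s, φ.Realize (Sum.elim x fun t => z (i, t)) := by
  have h₁ : ∀ j : Fin R, (Sum.elim a z ∘ Sum.elim (fun t => Sum.inr (j, t)) Sum.inl :
      Fin q ⊕ Fin p → N) = Sum.elim (fun t => z (j, t)) a := fun j => by
    ext (i | i) <;> rfl
  have h₂ : ∀ (j : Fin R) (x : Fin m → N), (Sum.elim (Sum.elim a z) x ∘
      Sum.elim Sum.inr (fun t => Sum.inl (Sum.inr (j, t))) : Fin m ⊕ Fin q → N) =
      Sum.elim x fun t => z (j, t) := fun j x => by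
    ext (i | i) <;> rfl
  simp only [conjugatesFormula, Formula.realize_inf, Formula.realize_iInf, Formula.realize_relabel,
    Formula.realize_not, Formula.realize_iExs, h₁, h₂, Subtype.forall]

/-- Finitely many conjugates and finitely many inconsistencies form one first-order statement over
`a`, which descends from the elementary extension to `N`. -/
theorem DividesOver.exists_realize_conjugatesFormula {N : Type} [L.Structure N] {m p q : ℕ}
    {φ : L.Formula (Fin m ⊕ Fin q)} {b : Fin q → N} {a : Fin p → N} (h : DividesOver φ b a) :
    ∃ k, 0 < k ∧ ∀ (R : ℕ) (χ : L.Formula (Fin q ⊕ Fin p)), χ.Realize (Sum.elim b a) →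
      ∃ z, (conjugatesFormula φ χ R k).Realize (Sum.elim a z) := by
  obtain ⟨N', _, j, k, c, hk, hc, hinc⟩ := h
  refine ⟨k, hk, fun R χ hχ => ?_⟩
  rw [← Formula.realize_iExs, ← j.map_formula, Formula.realize_iExs]
  refine ⟨fun i => c i.1 i.2, realize_conjugatesFormula.2 ⟨fun i => ?_, fun s hs => ?_⟩⟩
  · refine (hc i χ).2 ?_
    rwa [← Sum.comp_elim, j.map_formula]
  · rintro ⟨x, hx⟩
    refine hinc (s.map Fin.valEmbedding) (by rwa [Finset.card_map]) ⟨x, fun i hi => ?_⟩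
    obtain ⟨i, hi', rfl⟩ := Finset.mem_map.1 hi
    exact hx i hi'

/-! ### Comparing dimensions and finding small conjugates -/

namespace Construction

variable {T : L.Theory} {C : Construction T} {U : Ultrafilter ℕ}

theorem omegaSet_ofSeq {m q : ℕ} (φ : L.Formula (Fin m ⊕ Fin q)) (s : Fin q → ∀ n, C.M n) :
    C.omegaSet U φ (fun i => ofSeq (s i)) = C.internalSet U fun n =>
      {x | φ.Realize (Sum.elim x fun i => s i n) ∧
        ∀ i, x i ∈ (C.M n).V (Level.omegaAdd 0)} := by
  ext x
  constructor
  · rintro ⟨hx, hV⟩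
    obtain ⟨r, rfl⟩ := exists_ofSeq C U x
    exact ⟨r, fun _ => rfl, (realize_elim_ofSeq.1 hx).and
      (eventually_all.2 fun i => ofSeq_mem_V.1 (hV i))⟩
  · rintro ⟨r, hr, h⟩
    obtain rfl : x = fun i => ofSeq (r i) := funext hr
    exact ⟨realize_elim_ofSeq.2 (h.mono fun n hn => hn.1), fun i =>
      ofSeq_mem_V.2 (h.mono fun n hn => hn.2 i)⟩

theorem delta_lt_delta {m : ℕ} {D E : ∀ n, Set (Fin m → C.M n)}
    (hE : ∀ᶠ n in (U : Filter ℕ), (E n).Nonempty)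
    (h : ∀ r : ℕ, ∀ᶠ n in (U : Filter ℕ), (r + 1) * (D n).ncard ≤ (E n).ncard) :
    C.delta U (C.internalSet U D) < C.delta U (C.internalSet U E) := by
  have hE' : ∀ᶠ n in (U : Filter ℕ), 0 < (E n).ncard := hE.mono fun n hn =>
    (Set.ncard_pos (Set.toFinite _)).2 hn
  have hE0 : C.starCard U (C.internalSet U E) ≠ 0 := by
    rw [starCard_internalSet]
    intro h0
    obtain ⟨n, h₁, h₂⟩ := (hE'.and (Germ.coe_eq.1 h0)).exists
    simp only [Nat.cast_eq_zero] at h₂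
    omega
  rw [delta, delta, if_neg hE0]
  split_ifs with hD0
  · exact WithBot.bot_lt_coe _
  refine WithBot.coe_lt_coe.2 (DimGroup.mk_lt_mk fun k => ?_)
  rw [starCard_internalSet] at hD0 ⊢
  rw [starCard_internalSet]
  have hD' : ∀ᶠ n in (U : Filter ℕ), ((D n).ncard : ℝ) ≠ 0 :=
    Ultrafilter.eventually_not.2 fun h => hD0 (Germ.coe_eq.2 h)
  -- A factor of at least `exp k` in cardinality gives a gap of at least `k` between the logarithms.
  obtain ⟨r, hr⟩ := exists_nat_ge (Real.exp k)
  refine Germ.coe_le.2 ?_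
  filter_upwards [hD', h r] with n h₁ h₂
  have h₃ : (0 : ℝ) < (D n).ncard := lt_of_le_of_ne (Nat.cast_nonneg _) h₁.symm
  have h₄ : Real.exp k * (D n).ncard ≤ (E n).ncard :=
    (mul_le_mul_of_nonneg_right (hr.trans (by simp)) h₃.le).trans
      (by exact_mod_cast h₂ : ((r : ℝ) + 1) * (D n).ncard ≤ (E n).ncard)
  have h₅ := Real.log_le_log (by positivity) h₄
  rw [Real.log_mul (Real.exp_pos _).ne' h₃.ne', Real.log_exp] at h₅
  simp only [Function.comp_apply]
  rw [add_comm]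
  exact h₅

variable [L.IsRelational]

/-- The tuple from `M'` given by a tuple from `V_ω`. -/
def ofVOmega {q : ℕ} (b : Fin q → C.Ultra U) (hb : ∀ i, b i ∈ C.VOmega U) : Fin q → C.M' U :=
  fun i => ⟨b i, Set.mem_iUnion.2 ⟨0, hb i⟩⟩

variable (hT : IsModelComplete T) (hU : (U : Filter ℕ) ≤ cofinite)
include hT hU

/-- If `φ(x, b)` divides over `a`, then the type of `b` over `a` is approximated by tuples `b'` from
`V_ω` such that `φ(x, b')` has few solutions in comparison with `ψ(x, a)`. -/
theorem eventually_exists_small {m p q : ℕ} {ψ : L.Formula (Fin m ⊕ Fin p)}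
    {φ : L.Formula (Fin m ⊕ Fin q)} (hψ : ψ.IsExistential) (hφ : φ.IsExistential)
    {a : Fin p → ∀ n, C.M n} {a' : Fin p → C.M' U} {b : Fin q → C.M' U}
    (haa' : ∀ i, (a' i : C.Ultra U) = ofSeq (a i))
    (ha : ∀ i, (a' i : C.Ultra U) ∈ C.VltOmega U)
    (himp : ∀ x : Fin m → C.M' U, φ.Realize (Sum.elim x b) → ψ.Realize (Sum.elim x a'))
    (hdiv : DividesOver φ b a') {χ ε : L.Formula (Fin q ⊕ Fin p)}
    (hε : ∀ v : Fin q ⊕ Fin p → C.M' U, ε.Realize (Subtype.val ∘ v) ↔ χ.Realize v)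
    (hχ : χ.Realize (Sum.elim b a')) (r : ℕ) :
    ∀ᶠ n in (U : Filter ℕ), ∃ y : Fin q → C.M n, (∀ i, y i ∈ (C.M n).V (Level.omegaAdd 0)) ∧
      ε.Realize (Sum.elim y fun i => a i n) ∧
      (r + 1) * {x | φ.Realize (Sum.elim x y) ∧
          ∀ i, x i ∈ (C.M n).V (Level.omegaAdd 0)}.ncard ≤
        {x | ψ.Realize (Sum.elim x fun i => a i n) ∧
          ∀ i, x i ∈ (C.M n).V (Level.omegaAdd 0)}.ncard := by
  obtain ⟨k, hk, hconj⟩ := hdiv.exists_realize_conjugatesFormula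
  -- The implication `φ(x, y) → ψ(x, a)` is made part of the type, so that the conjugates inherit
  -- it.
  let ι : L.Formula (Fin q ⊕ Fin p) := Formula.iAlls (Fin m)
    ((φ.relabel (Sum.elim Sum.inr (Sum.inl ∘ Sum.inl))).imp
      (ψ.relabel (Sum.elim Sum.inr (Sum.inl ∘ Sum.inr))))
  have hι : ∀ y : Fin q → C.M' U, ι.Realize (Sum.elim y a') ↔
      ∀ x : Fin m → C.M' U, φ.Realize (Sum.elim x y) → ψ.Realize (Sum.elim x a') := by
    intro y
    have h₁ : ∀ x : Fin m → C.M' U, (Sum.elim (Sum.elim y a') x ∘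
        Sum.elim Sum.inr (Sum.inl ∘ Sum.inl) : Fin m ⊕ Fin q → C.M' U) = Sum.elim x y := by
      intro x
      ext (i | i) <;> rfl
    have h₂ : ∀ x : Fin m → C.M' U, (Sum.elim (Sum.elim y a') x ∘
        Sum.elim Sum.inr (Sum.inl ∘ Sum.inr) : Fin m ⊕ Fin p → C.M' U) = Sum.elim x a' := by
      intro x
      ext (i | i) <;> rfl
    simp only [ι, Formula.realize_iAlls, Formula.realize_imp, Formula.realize_relabel, h₁, h₂]
  -- With `k(r+1)` conjugates the counting bound `k / R` becomes `1/(r+1)`.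
  have hR : 0 < k * (r + 1) := Nat.mul_pos hk r.succ_pos
  obtain ⟨z, hzV, hz⟩ := C.exists_mem_VOmega hT hU _ ha
    (hconj (k * (r + 1)) (χ ⊓ ι) (Formula.realize_inf.2 ⟨hχ, (hι b).2 himp⟩))
  rw [realize_conjugatesFormula] at hz
  simp only [Formula.realize_inf, hι] at hz
  obtain ⟨hχz, hinc⟩ := hz
  obtain ⟨s, hs⟩ := exists_ofSeq C U fun i => (z i : C.Ultra U)
  have hs' : ∀ i, (z i : C.Ultra U) = ofSeq (s i) := fun i => congrFun hs i
  have h₁ : ∀ᶠ n in (U : Filter ℕ), ∀ j i, s (j, i) n ∈ (C.M n).V (Level.omegaAdd 0) :=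
    eventually_all.2 fun j => eventually_all.2 fun i => ofSeq_mem_V.1 (hs' (j, i) ▸ hzV (j, i))
  have h₂ : ∀ᶠ n in (U : Filter ℕ), ∀ j,
      ε.Realize (Sum.elim (fun i => s (j, i) n) fun i => a i n) :=
    eventually_all.2 fun j => by
      have := (hε _).2 (hχz j).1
      rw [Sum.comp_elim] at this
      rw [← realize_elim_ofSeq]
      convert this using 2
      · ext i; exact (hs' _).symm
      · ext i; exact (haa' _).symm
  have hφM : ∀ (j) (x : Fin m → ∀ n, C.M n) (hx : ∀ i, (ofSeq (x i) : C.Ultra U) ∈ C.VOmega U),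
      φ.Realize (Sum.elim (ofVOmega _ hx) fun i => z (j, i)) ↔
        ∀ᶠ n in (U : Filter ℕ), φ.Realize (Sum.elim (fun i => x i n) fun i => s (j, i) n) := by
    intro j x hx
    rw [← realize_val_iff_of_isExistential hT hU hφ, ← realize_elim_ofSeq, Sum.comp_elim]
    simp only [Function.comp_def, hs', ofVOmega]
  have hψM : ∀ (x : Fin m → ∀ n, C.M n) (hx : ∀ i, (ofSeq (x i) : C.Ultra U) ∈ C.VOmega U),
      ψ.Realize (Sum.elim (ofVOmega _ hx) a') ↔
        ∀ᶠ n in (U : Filter ℕ), ψ.Realize (Sum.elim (fun i => x i n) fun i => a i n) := by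
    intro x hx
    rw [← realize_val_iff_of_isExistential hT hU hψ, ← realize_elim_ofSeq, Sum.comp_elim]
    simp only [Function.comp_def, haa', ofVOmega]
  have h₃ : ∀ᶠ n in (U : Filter ℕ), ∀ j, ∀ x : Fin m → C.M n,
      (∀ i, x i ∈ (C.M n).V (Level.omegaAdd 0)) →
      φ.Realize (Sum.elim x fun i => s (j, i) n) → ψ.Realize (Sum.elim x fun i => a i n) := by
    refine eventually_all.2 fun j => ?_
    -- Counterexamples in almost all `M_n` would assemble to a tuple from `V_ω^M`, hence from `M'`,
    -- refuting the implication there.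
    by_contra h
    rw [← Ultrafilter.eventually_not] at h
    push Not at h
    obtain ⟨x, hx⟩ := exists_eventually h
    have hxV : ∀ i, (ofSeq (x i) : C.Ultra U) ∈ C.VOmega U := fun i =>
      ofSeq_mem_V.2 (hx.mono fun n hn => hn.1 i)
    have := (hψM x hxV).1 ((hχz j).2 _ ((hφM j x hxV).2 (hx.mono fun n hn => hn.2.1)))
    obtain ⟨n, hn, hn'⟩ := (hx.and this).exists
    exact hn.2.2 hn'
  have h₄ : ∀ᶠ n in (U : Filter ℕ), ∀ t : Finset (Fin (k * (r + 1))), t.card = k →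
      ¬ ∃ x : Fin m → C.M n, ∀ j ∈ t, φ.Realize (Sum.elim x fun i => s (j, i) n) ∧
        ∀ i, x i ∈ (C.M n).V (Level.omegaAdd 0) := by
    refine eventually_all.2 fun t => ?_
    by_contra h
    rw [← Ultrafilter.eventually_not] at h
    push Not at h
    obtain ⟨n, htk, -⟩ := h.exists
    obtain ⟨x, hx⟩ := exists_eventually (h.mono fun n hn => hn.2)
    -- Membership in `V_ω` is asserted only for indices in `t`, so `t` must be nonempty; this uses
    -- `0 < k`.
    obtain ⟨j₀, hj₀⟩ := Finset.card_pos.1 (htk ▸ hk)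
    have hxV : ∀ i, (ofSeq (x i) : C.Ultra U) ∈ C.VOmega U := fun i =>
      ofSeq_mem_V.2 (hx.mono fun n hn => (hn j₀ hj₀).2 i)
    exact hinc t htk ⟨ofVOmega _ hxV, fun j hj =>
      (hφM j x hxV).2 (hx.mono fun n hn => (hn j hj).1)⟩
  filter_upwards [h₁, h₂, h₃, h₄] with n h₁ h₂ h₃ h₄
  obtain ⟨j, hj⟩ := exists_mul_ncard_le hR
    (fun j => {x : Fin m → C.M n | φ.Realize (Sum.elim x fun i => s (j, i) n) ∧
      ∀ i, x i ∈ (C.M n).V (Level.omegaAdd 0)})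
    {x | ψ.Realize (Sum.elim x fun i => a i n) ∧ ∀ i, x i ∈ (C.M n).V (Level.omegaAdd 0)}
    (fun j x hx => ⟨h₃ j x hx.2 hx.1, hx.2⟩) h₄
  exact ⟨fun i => s (j, i) n, h₁ j, h₂ j, Nat.le_of_mul_le_mul_left (by rwa [← mul_assoc]) hk⟩

end Construction

end FinePseudofinite

/-! ### The proposition -/

open FinePseudofinite FinePseudofinite.Construction in
theorem mainTheorem2 {L : FirstOrder.Language.{0, 0}} [L.IsRelational] [Countable L.Symbols]
    (T : L.Theory) (hT : T.IsComplete) (hMC : FinePseudofinite.IsModelComplete T)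
    (C : FinePseudofinite.Construction T)
    (U : Ultrafilter ℕ) (hU : (U : Filter ℕ) ≤ Filter.cofinite)
    {m p q : ℕ} (ψ : L.Formula (Fin m ⊕ Fin p)) (φ : L.Formula (Fin m ⊕ Fin q))
    (hψ : ψ.IsExistential) (hφ : φ.IsExistential)
    (a : Fin p → C.M' U) (b : Fin q → C.M' U)
    (ha : ∀ i, (a i : C.Ultra U) ∈ C.VltOmega U)
    (hb : ∀ i, (b i : C.Ultra U) ∈ C.VOmega U)
    (hψa : ∃ x : Fin m → C.M' U, ψ.Realize (Sum.elim x a))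
    (himp : ∀ x : Fin m → C.M' U, φ.Realize (Sum.elim x b) → ψ.Realize (Sum.elim x a))
    (hdiv : FinePseudofinite.DividesOver φ b a) :
    ∃ b' : Fin q → C.M' U,
      (∀ i, (b' i : C.Ultra U) ∈ C.VOmega U) ∧
      FinePseudofinite.SameTypeOver (L := L) a b' b ∧
      C.delta U (C.omegaSet U φ fun i => (b' i : C.Ultra U)) <
        C.delta U (C.omegaSet U ψ fun i => (a i : C.Ultra U)) := by
  obtain ⟨s, hs⟩ := exists_ofSeq C U fun i => (a i : C.Ultra U)
  have hs' : ∀ i, (a i : C.Ultra U) = ofSeq (s i) := fun i => congrFun hs i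
  choose ε hε using C.exists_realize_val_iff (U := U) hMC hU (α := Fin q ⊕ Fin p)
  -- Countability of the language lets the type of `b` over `a` be listed as `χ 0, χ 1, …`, as
  -- saturation requires.
  obtain ⟨χ, hχ⟩ := (Set.to_countable
    {χ : L.Formula (Fin q ⊕ Fin p) | χ.Realize (Sum.elim b a)}).exists_eq_range
    ⟨⊤, by simp [Formula.Realize]⟩
  have hχb : ∀ l, (χ l).Realize (Sum.elim b a) := fun l =>
    (Set.ext_iff.1 hχ (χ l)).2 ⟨l, rfl⟩
  have hconj : ∀ (r : ℕ) {A : Type} [L.Structure A] (v : Fin q ⊕ Fin p → A)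
      (f : ℕ → L.Formula (Fin q ⊕ Fin p)),
      (Formula.iInf fun l : Fin (r + 1) => f l).Realize v ↔ ∀ l ≤ r, (f l).Realize v := by
    intro r A _ v f
    rw [Formula.realize_iInf]
    exact ⟨fun h l hl => h ⟨l, Nat.lt_succ_of_le hl⟩, fun h l => h l (Nat.le_of_lt_succ l.2)⟩
  obtain ⟨y, hy⟩ := exists_forall_eventually hU (X := fun n => Fin q → C.M n)
    (P := fun r n y => (∀ i, y i ∈ (C.M n).V (Level.omegaAdd 0)) ∧
      (∀ l ≤ r, (ε (χ l)).Realize (Sum.elim y fun i => s i n)) ∧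
      (r + 1) * {x | φ.Realize (Sum.elim x y) ∧
          ∀ i, x i ∈ (C.M n).V (Level.omegaAdd 0)}.ncard ≤
        {x | ψ.Realize (Sum.elim x fun i => s i n) ∧
          ∀ i, x i ∈ (C.M n).V (Level.omegaAdd 0)}.ncard)
    (fun n x r r' hr h => ⟨h.1, fun l hl => h.2.1 l (hl.trans hr),
      (Nat.mul_le_mul_right _ (Nat.succ_le_succ hr)).trans h.2.2⟩) (by
    intro r
    have := eventually_exists_small hMC hU hψ hφ hs' ha himp hdiv
      (χ := Formula.iInf fun l : Fin (r + 1) => χ l)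
      (ε := Formula.iInf fun l : Fin (r + 1) => ε (χ l))
      (fun v => by
        rw [hconj r v χ, hconj r _ fun l => ε (χ l)]
        exact forall₂_congr fun l _ => hε (χ l) v)
      ((hconj r _ χ).2 fun l _ => hχb l) r
    refine this.mono fun n => ?_
    rintro ⟨y, h₁, h₂, h₃⟩
    exact ⟨y, h₁, (hconj r _ fun l => ε (χ l)).1 h₂, h₃⟩)
  have hyV : ∀ i, (ofSeq (fun n => y n i) : C.Ultra U) ∈ C.VOmega U := fun i =>
    ofSeq_mem_V.2 ((hy 0).mono fun n hn => hn.1 i)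
  have hχy : ∀ l, (χ l).Realize (Sum.elim (ofVOmega _ hyV) a) := fun l => by
    rw [← hε, Sum.comp_elim]
    have := realize_elim_ofSeq.2 ((hy l).mono fun n hn => hn.2.1 l le_rfl)
    simpa only [Function.comp_def, hs', ofVOmega] using this
  refine ⟨ofVOmega _ hyV, hyV, fun χ' => ⟨fun h => ?_, fun h => ?_⟩, ?_⟩
  -- The type of `b` is complete: if `b` fails `χ'`, then the negation of `χ'` is in the list.
  · by_contra hb'
    obtain ⟨l, hl⟩ := (Set.ext_iff.1 hχ χ'.not).1 (Formula.realize_not.2 hb')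
    exact Formula.realize_not.1 (hl ▸ hχy l) h
  · obtain ⟨l, rfl⟩ := (Set.ext_iff.1 hχ χ').1 h
    exact hχy l
  · simp only [ofVOmega, hs']
    rw [omegaSet_ofSeq φ fun i n => y n i, omegaSet_ofSeq]
    refine delta_lt_delta ?_ fun r => (hy r).mono fun n hn => hn.2.2
    -- Consistency of `ψ(x, a)` in `M'` must yield a solution in `V_ω`, so that the larger dimension
    -- is not `-∞`; the swap puts the parameters first.
    let ρ : L.Formula (Fin p ⊕ Fin m) := ψ.relabel Sum.swap
    have hρ : ∀ x : Fin m → C.M' U, ρ.Realize (Sum.elim a x) ↔ ψ.Realize (Sum.elim x a) :=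
      fun x => by simp only [ρ, Formula.realize_relabel, Sum.elim_swap]
    obtain ⟨x₀, hx₀⟩ := hψa
    obtain ⟨x, hxV, hx⟩ := C.exists_mem_VOmega hMC hU ρ ha ⟨x₀, (hρ x₀).2 hx₀⟩
    obtain ⟨r, hr⟩ := exists_ofSeq C U fun i => (x i : C.Ultra U)
    have hr' : ∀ i, (x i : C.Ultra U) = ofSeq (r i) := fun i => congrFun hr i
    have h₁ := (C.realize_val_iff_of_isExistential hMC hU hψ _).2 ((hρ x).1 hx)
    rw [Sum.comp_elim] at h₁
    simp only [Function.comp_def, hs', hr'] at h₁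
    filter_upwards [realize_elim_ofSeq.1 h₁,
      eventually_all.2 fun i => ofSeq_mem_V.1 (hr' i ▸ hxV i)] with n h₁ h₂
    exact ⟨_, h₁, h₂⟩
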